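/- Let $a\in\mathbb{Q}$ and let $f(x,y,z)=\left(y,\,z,\,\frac{a+y+z}{x}\right)$, defined on $\{(x,y,z)\in\mathbb{C}^3 : x\neq 0\}$. For a fixed point $q$ of $f$, a \emph{meromorphic first integral} of $f$ near $q$ is a quotient $R=G/H$ of functions $G,H$ analytic in a neighbourhood of $q$, with $H\not\equiv 0$ near $q$, such that $G(f(p))\,H(p)=G(p)\,H(f(p))$ for all $p$ in a neighbourhood of $q$. Meromorphic functions $R_i=G_i/H_i$ $(1\le i\le m)$ are \emph{functionally independent} near $q$ if every neighbourhood of $q$ contains a point at which no $H_i$ vanishes and the differentials $dR_1,\dots,dR_m$ are linearly independent over $\mathbb{C}$. If $f$ has, near each of its fixed points, three functionally independent meromorphic first integrals (in particular, if $f$ has three functionally independent meromorphic first integrals defined on all of $\mathbb{C}^3$), then $a\in\{-1,1\}$. -/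

import Mathlib

open Filter Topology

/-- The map `(x, y, z) ↦ (y, z, (a + y + z) / x)` on `ℂ³`. It is meaningful only where `x ≠ 0`;
the division convention of the library at `x = 0` is never used below. -/
noncomputable def toddMap (a : ℂ) (p : Fin 3 → ℂ) : Fin 3 → ℂ :=
  ![p 1, p 2, (a + p 1 + p 2) / p 0]

/-- `q` is a fixed point of `toddMap a`, in the domain `x ≠ 0` of this map. -/
def IsToddFixedPoint (a : ℂ) (q : Fin 3 → ℂ) : Prop :=
  q 0 ≠ 0 ∧ toddMap a q = q

/-- `G / H` is a meromorphic first integral of `f` in a neighbourhood of the point `q`: `G` and `H`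
are analytic near `q`, `H` is not identically zero near `q`, and
`G (f x) * H x = G x * H (f x)` for all `x` near `q`. -/
structure IsMeromorphicFirstIntegralAt {n : ℕ} (f : (Fin n → ℂ) → (Fin n → ℂ)) (q : Fin n → ℂ)
    (G H : (Fin n → ℂ) → ℂ) : Prop where
  analyticAt_num : AnalyticAt ℂ G q
  analyticAt_den : AnalyticAt ℂ H q
  den_ne_zero : ¬ ∀ᶠ x in 𝓝 q, H x = 0
  invariant : ∀ᶠ x in 𝓝 q, G (f x) * H x = G x * H (f x)

/-- The meromorphic functions `G i / H i` are functionally independent near `q`: in every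
neighbourhood of `q` there is a point where no denominator vanishes and where the differentials
of the quotients are linearly independent. (The maximal minors of the Jacobian matrix are
meromorphic, so the differentials are then independent on an open dense subset of every
sufficiently small ball around `q`.) -/
def FunctionallyIndependentAt {n m : ℕ} (q : Fin n → ℂ) (G H : Fin m → (Fin n → ℂ) → ℂ) : Prop :=
  ∃ᶠ x in 𝓝 q, (∀ i, H i x ≠ 0) ∧
    LinearIndependent ℂ (fun i => fderiv ℂ (fun y => G i y / H i y) x)

/-- Near `q`, the map `f` has `m` functionally independent meromorphic first integrals. -/
def HasIndependentMeromorphicFirstIntegralsAt {n : ℕ} (f : (Fin n → ℂ) → (Fin n → ℂ))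
    (q : Fin n → ℂ) (m : ℕ) : Prop :=
  ∃ G H : Fin m → (Fin n → ℂ) → ℂ,
    (∀ i, IsMeromorphicFirstIntegralAt f q (G i) (H i)) ∧ FunctionallyIndependentAt q G H

/-!
The map has the fixed points `(x, x, x)` with `x ≠ 0` and `x ^ 2 = a + 2 * x`. Its linear part there
has the eigenvalues `-1`, `μ`, `μ⁻¹` with `μ + μ⁻¹ = 1 + 1 / x`. The analytic half of the proof shows
that three functionally independent meromorphic first integrals near such a point force `μ` to be
a root of unity (`exists_pow_eq_one_of_todd`). The arithmetic half is then short: the numbers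
`1 + 1 / x` are algebraic integers of absolute value at most `2`. For `a ≠ 0` the sum and the product
of these numbers over the two roots `x` are `2 - 2 / a` and `1 - 3 / a`, so `m = 1 / a` is an integer
with `|1 - 3 * m| ≤ 4`, and `m = ±1`. For `a = 0` the fixed point `(2, 2, 2)` gives the number
`3 / 2`, which is not integral.

The analytic half is a dimension count. Write the first integrals as `G i / H` with a common
denominator. If `Φ` is a homogeneous polynomial of degree `N` and `F = Φ(H, G)`, then `F / H ^ N` is
again invariant, hence so is the quotient of the leading forms of `F` and `H ^ N` under the linear
part (`IsLeadingForm.scaleVars_mul_pow_eq`). In eigencoordinates, comparing leading monomials for a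
monomial order shows that the leading exponent `γ` of `F` has the eigenvalue `λ ^ γ = κ`, where `κ`
depends on `N` and `H` only (`prod_pow_degree_eq`). Moreover `F` vanishes at the fixed point to an
order at most a constant times `N` (`order_eval_denomNum_le`): by Euler's identity, the partial
derivatives of `Φ` at `(H, G)` are obtained from `F` and its differential by inverting the Jacobian
matrix of the `G i / H`, at a bounded cost in order, and the degree of `Φ` drops each time.

So a polynomial `Φ` in a space of dimension of the order of `N ^ 3` is determined by the Taylor
coefficients of `F` at the exponents `γ` of degree `O(N)` with `λ ^ γ = κ`
(`exists_pow_card_le_card`). If `μ` is not a root of unity, the first two components of such an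
exponent determine the third, and there are only `O(N ^ 2)` of them, which is a contradiction for
large `N`.
-/

/-! ### Leading forms of analytic functions -/

section LeadingForm

open MvPolynomial Asymptotics

theorem isBigO_shift {E : Type*} [NormedAddCommGroup E] {F : E → ℂ} {q : E} {k : ℕ} :
    F =O[𝓝 q] (fun x => ‖x - q‖ ^ k) ↔ (fun y => F (q + y)) =O[𝓝 0] fun y => ‖y‖ ^ k := by
  constructor
  · intro h
    have : Tendsto (fun y => q + y) (𝓝 0) (𝓝 q) := by
      have : ContinuousAt (fun y => q + y) 0 := by fun_prop
      simpa [ContinuousAt] using this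
    simpa [Function.comp_def] using h.comp_tendsto this
  · intro h
    have : Tendsto (fun x => x - q) (𝓝 q) (𝓝 0) := by
      have : ContinuousAt (fun x => x - q) q := by fun_prop
      simpa [ContinuousAt] using this
    simpa [Function.comp_def] using h.comp_tendsto this

variable {ι E : Type*} [Fintype ι] [NormedAddCommGroup E] [NormedSpace ℂ E]

/-- The homogeneous term of degree `k` of a power series, as a polynomial in the coordinates with
respect to the basis `b`. It depends linearly on the series. -/
noncomputable def taylorForm (b : Module.Basis ι ℂ E) (k : ℕ) :
    FormalMultilinearSeries ℂ E ℂ →ₗ[ℂ] MvPolynomial ι ℂ where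
  toFun p := ∑ r : Fin k → ι, C (p k fun j => b (r j)) * ∏ j, X (r j)
  map_add' p p' := by
    rw [← Finset.sum_add_distrib]
    refine Finset.sum_congr rfl fun r _ => ?_
    rw [← add_mul, ← C_add]
    rfl
  map_smul' c p := by
    simp only [RingHom.id_apply, Finset.smul_sum, smul_eq_C_mul, ← mul_assoc, ← C_mul]
    rfl

theorem isHomogeneous_taylorForm (b : Module.Basis ι ℂ E) (k : ℕ)
    (p : FormalMultilinearSeries ℂ E ℂ) : (taylorForm b k p).IsHomogeneous k := by
  refine IsHomogeneous.sum _ _ _ fun r _ => IsHomogeneous.C_mul ?_ _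
  simpa using IsHomogeneous.prod Finset.univ (fun j => (X (r j) : MvPolynomial ι ℂ)) (fun _ => 1)
    fun j _ => isHomogeneous_X ℂ (r j)

theorem eval_taylorForm (b : Module.Basis ι ℂ E) (k : ℕ) (p : FormalMultilinearSeries ℂ E ℂ)
    (y : E) : eval (b.equivFun y) (taylorForm b k p) = p k fun _ => y := by
  classical
  have h : (p k fun _ => y) = p k fun _ => ∑ i, b.equivFun y i • b i := by
    simp only [b.sum_equivFun]
  rw [h, (p k).map_sum]
  simp only [taylorForm, LinearMap.coe_mk, AddHom.coe_mk, map_sum, map_mul, map_prod, eval_C,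
    eval_X, (p k).map_smul_univ, smul_eq_mul, mul_comm]

/-- The homogeneous polynomial `P ≠ 0` of degree `d` is the leading form of `F` at `q`, in the
coordinates of the basis `b`: the function `F (q + y)` differs from `P` by `O(‖y‖ ^ (d + 1))`. -/
structure IsLeadingForm (b : Module.Basis ι ℂ E) (F : E → ℂ) (q : E) (d : ℕ)
    (P : MvPolynomial ι ℂ) : Prop where
  isHomogeneous : P.IsHomogeneous d
  ne_zero : P ≠ 0
  isBigO : (fun y => F (q + y) - eval (b.equivFun y) P) =O[𝓝 0] fun y => ‖y‖ ^ (d + 1)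

/-- A function with a power series expansion that is not locally zero has a leading form, namely
the first non-zero homogeneous term of the series. -/
theorem HasFPowerSeriesAt.exists_isLeadingForm (b : Module.Basis ι ℂ E) {F : E → ℂ} {q : E}
    {p : FormalMultilinearSeries ℂ E ℂ} (hp : HasFPowerSeriesAt F p q)
    (hF : ¬ ∀ᶠ x in 𝓝 q, F x = 0) :
    ∃ d, IsLeadingForm b F q d (taylorForm b d p) ∧ F =O[𝓝 q] fun x => ‖x - q‖ ^ d := by
  have hex : ∃ d, taylorForm b d p ≠ 0 := by
    by_contra! h
    apply hF
    obtain ⟨r, hr⟩ := hp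
    have h0 : ∀ y ∈ Metric.eball (0 : E) r, F (q + y) = 0 := by
      intro y hy
      have hs := hr.hasSum hy
      have : ∀ k, (p k fun _ => y) = 0 := fun k => by
        rw [← eval_taylorForm b, h k, map_zero]
      simp only [this] at hs
      exact hs.unique hasSum_zero
    filter_upwards [Metric.eball_mem_nhds q hr.r_pos] with x hx
    have := h0 (x - q) (by simpa [edist_eq_enorm_sub] using hx)
    simpa using this
  classical
  have hlt : ∀ y : E, p.partialSum (Nat.find hex) y = 0 := fun y =>
    Finset.sum_eq_zero fun k hk => by
      have := Nat.find_min hex (Finset.mem_range.mp hk)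
      rw [← eval_taylorForm b, not_not.mp this, map_zero]
  refine ⟨Nat.find hex, ⟨isHomogeneous_taylorForm _ _ _, Nat.find_spec hex, ?_⟩, ?_⟩
  · have h := hp.isBigO_sub_partialSum_pow (Nat.find hex + 1)
    refine h.congr_left fun y => ?_
    rw [FormalMultilinearSeries.partialSum, Finset.sum_range_succ, eval_taylorForm]
    rw [show ∑ x ∈ Finset.range (Nat.find hex), ((p x) fun _ ↦ y) = 0 from hlt y, zero_add]
  · rw [isBigO_shift]
    simpa [hlt] using hp.isBigO_sub_partialSum_pow (Nat.find hex)

/-- Along a curve leaving `q` in the direction `v`, the leading form at `v` is the first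
coefficient of `F`. -/
theorem IsLeadingForm.tendsto {b : Module.Basis ι ℂ E} {F : E → ℂ} {q : E} {d : ℕ}
    {P : MvPolynomial ι ℂ} (h : IsLeadingForm b F q d P) {w : ℂ → E} {v : E}
    (hw : Tendsto w (𝓝[≠] 0) (𝓝 v)) :
    Tendsto (fun t => (t ^ d)⁻¹ * F (q + t • w t)) (𝓝[≠] 0) (𝓝 (eval (b.equivFun v) P)) := by
  have hid : Tendsto (fun t : ℂ => t) (𝓝[≠] 0) (𝓝 0) := tendsto_id.mono_left nhdsWithin_le_nhds
  have htw : Tendsto (fun t => t • w t) (𝓝[≠] 0) (𝓝 0) := by simpa using hid.smul hw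
  have : FiniteDimensional ℂ E := b.finiteDimensional_of_finite
  have hcont : Continuous fun y => eval (b.equivFun y) P :=
    (MvPolynomial.continuous_eval P).comp b.equivFun.toLinearMap.continuous_of_finiteDimensional
  have h1 : Tendsto (fun t => eval (b.equivFun (w t)) P) (𝓝[≠] 0)
      (𝓝 (eval (b.equivFun v) P)) := (hcont.tendsto v).comp hw
  have h2 : Tendsto (fun t => (t ^ d)⁻¹ *
      (F (q + t • w t) - eval (b.equivFun (t • w t)) P)) (𝓝[≠] 0) (𝓝 0) := by
    have ho := h.isBigO.comp_tendsto htw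
    have h3 : (fun t => (t ^ d)⁻¹ * (F (q + t • w t) - eval (b.equivFun (t • w t)) P))
        =O[𝓝[≠] 0] fun t => (t ^ d)⁻¹ * t ^ (d + 1) := by
      refine (isBigO_refl _ _).mul ?_
      refine ho.trans ?_
      have hb : (fun t => w t) =O[𝓝[≠] 0] fun _ => (1 : ℂ) := hw.isBigO_one ℂ
      have := ((isBigO_refl (fun t : ℂ => t) (𝓝[≠] 0)).smul hb).norm_left.pow (d + 1)
      simpa [Function.comp_def] using this
    refine h3.trans_tendsto ?_
    refine hid.congr' ?_
    filter_upwards [self_mem_nhdsWithin] with t ht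
    have ht : t ≠ 0 := ht
    field_simp
    ring
  have h4 := h2.add h1
  rw [zero_add] at h4
  refine h4.congr' ?_
  filter_upwards [self_mem_nhdsWithin] with t ht
  have ht : t ≠ 0 := ht
  have he : eval (b.equivFun (t • w t)) P = t ^ d * eval (b.equivFun (w t)) P := by
    rw [map_smul, eval_eq, eval_eq, Finset.mul_sum]
    refine Finset.sum_congr rfl fun m hm => ?_
    have hdeg : ∑ i ∈ m.support, m i = d :=
      (h.isHomogeneous.degree_eq_sum_deg_support hm).symm
    simp only [Pi.smul_apply, smul_eq_mul, mul_pow, Finset.prod_mul_distrib,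
      Finset.prod_pow_eq_pow_sum, hdeg]
    ring
  rw [he]
  field_simp
  ring

theorem eq_zero_of_isBigO_of_tendsto {F : E → ℂ} {q v : E} {k d : ℕ} {L : ℂ}
    (hF : F =O[𝓝 q] fun x => ‖x - q‖ ^ k) (hdk : d < k)
    (hL : Tendsto (fun t : ℂ => (t ^ d)⁻¹ * F (q + t • v)) (𝓝[≠] 0) (𝓝 L)) : L = 0 := by
  have hid : Tendsto (fun t : ℂ => t) (𝓝[≠] 0) (𝓝 0) := tendsto_id.mono_left nhdsWithin_le_nhds
  have htw : Tendsto (fun t : ℂ => t • v) (𝓝[≠] 0) (𝓝 0) := by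
    simpa using hid.smul (tendsto_const_nhds (x := v))
  have ho := (isBigO_shift.mp hF).comp_tendsto htw
  have h3 : (fun t : ℂ => (t ^ d)⁻¹ * F (q + t • v)) =O[𝓝[≠] 0] fun t => (t ^ d)⁻¹ * t ^ k := by
    refine (isBigO_refl _ _).mul (ho.trans ?_)
    have := ((isBigO_refl (fun t : ℂ => t) (𝓝[≠] 0)).smul
      (isBigO_const_const v (one_ne_zero (α := ℂ)) _)).norm_left.pow k
    simpa [Function.comp_def] using this
  refine tendsto_nhds_unique hL (h3.trans_tendsto ?_)
  have : Tendsto (fun t : ℂ => t ^ (k - d)) (𝓝[≠] 0) (𝓝 0) := by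
    simpa [(Nat.sub_pos_of_lt hdk).ne'] using hid.pow (k - d)
  refine this.congr' ?_
  filter_upwards [self_mem_nhdsWithin] with t ht
  have ht : t ≠ 0 := ht
  rw [eq_inv_mul_iff_mul_eq₀ (pow_ne_zero _ ht), ← pow_add, Nat.add_sub_cancel' hdk.le]

theorem eq_zero_of_forall_eval_equivFun (b : Module.Basis ι ℂ E) {P : MvPolynomial ι ℂ}
    (h : ∀ v, eval (b.equivFun v) P = 0) : P = 0 :=
  MvPolynomial.funext fun r => by
    rw [map_zero, ← h (b.equivFun.symm r), LinearEquiv.apply_symm_apply]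

theorem IsLeadingForm.le_of_isBigO {b : Module.Basis ι ℂ E} {F : E → ℂ} {q : E} {d k : ℕ}
    {P : MvPolynomial ι ℂ} (h : IsLeadingForm b F q d P)
    (hF : F =O[𝓝 q] fun x => ‖x - q‖ ^ k) : k ≤ d := by
  by_contra! hlt
  exact h.ne_zero <| eq_zero_of_forall_eval_equivFun b fun v =>
    eq_zero_of_isBigO_of_tendsto hF hlt (h.tendsto tendsto_const_nhds)

/-- A function of order `e` can be cancelled from a vanishing estimate, at the cost of `e`. -/
theorem IsLeadingForm.isBigO_of_mul {b : Module.Basis ι ℂ E} {F D : E → ℂ} {q : E} {e k : ℕ}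
    {Q : MvPolynomial ι ℂ} (hD : IsLeadingForm b D q e Q) (hF : AnalyticAt ℂ F q)
    (h : (fun x => F x * D x) =O[𝓝 q] fun x => ‖x - q‖ ^ k) :
    F =O[𝓝 q] fun x => ‖x - q‖ ^ (k - e) := by
  by_cases h0 : ∀ᶠ x in 𝓝 q, F x = 0
  · exact (isBigO_zero _ _).congr' (h0.mono fun x hx => hx.symm) EventuallyEq.rfl
  obtain ⟨p, hp⟩ := hF
  obtain ⟨d, hd, hO⟩ := hp.exists_isLeadingForm b h0
  have hk : k ≤ d + e := by
    by_contra! hlt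
    refine mul_ne_zero hd.ne_zero hD.ne_zero ?_
    refine eq_zero_of_forall_eval_equivFun b fun v => ?_
    refine eq_zero_of_isBigO_of_tendsto (v := v) h hlt ?_
    rw [map_mul]
    refine ((hd.tendsto (w := fun _ => v) tendsto_const_nhds).mul
      (hD.tendsto (w := fun _ => v) tendsto_const_nhds)).congr fun t => ?_
    rw [pow_add, mul_inv]
    ring
  refine hO.trans (isBigO_iff.mpr ⟨1, ?_⟩)
  filter_upwards [Metric.ball_mem_nhds q one_pos] with x hx
  rw [Metric.mem_ball, dist_eq_norm] at hx
  simpa using pow_le_pow_of_le_one (norm_nonneg _) hx.le (by omega)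

/-- By Cauchy's estimate, a derivative of an analytic function vanishing to order `k` vanishes to
order `k - 1`. -/
theorem AnalyticAt.isBigO_fderiv {F : E → ℂ} {q : E} {k : ℕ} (hF : AnalyticAt ℂ F q)
    (h : F =O[𝓝 q] fun x => ‖x - q‖ ^ k) (v : E) :
    (fun x => fderiv ℂ F x v) =O[𝓝 q] fun x => ‖x - q‖ ^ (k - 1) := by
  by_cases hk : k ≤ 1
  · rw [Nat.sub_eq_zero_of_le hk]
    simp only [pow_zero]
    have : ContinuousAt (fun x => fderiv ℂ F x v) q :=
      hF.fderiv.continuousAt.clm_apply continuousAt_const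
    exact this.tendsto.isBigO_one ℝ
  push Not at hk
  obtain ⟨c, hc⟩ := isBigO_iff.mp h
  have han := hF.eventually_analyticAt
  obtain ⟨ε, hε, hball⟩ := Metric.eventually_nhds_iff_ball.mp (hc.and han)
  -- The estimate is applied on the circle of radius `‖x - q‖ / (‖v‖ + 1)` in the direction `v`;
  -- the summand `1` covers the case `v = 0`.
  refine isBigO_iff.mpr ⟨c * 2 ^ k * (‖v‖ + 1), ?_⟩
  filter_upwards [Metric.ball_mem_nhds q (half_pos hε)] with x hx
  rw [Metric.mem_ball, dist_eq_norm] at hx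
  by_cases hxq : x = q
  · subst hxq
    rw [(h.hasFDerivAt hk).fderiv]
    simp [Nat.sub_ne_zero_of_lt hk]
  have hpos : 0 < ‖x - q‖ := norm_pos_iff.mpr (sub_ne_zero.mpr hxq)
  set R := ‖x - q‖ / (‖v‖ + 1) with hR
  have hv : 0 < ‖v‖ + 1 := by positivity
  have hRpos : 0 < R := div_pos hpos hv
  have hmem : ∀ z : ℂ, ‖z‖ ≤ R → ‖x + z • v - q‖ ≤ 2 * ‖x - q‖ := by
    intro z hz
    have h1 : ‖z • v‖ ≤ ‖x - q‖ := by
      rw [norm_smul]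
      calc ‖z‖ * ‖v‖ ≤ R * (‖v‖ + 1) := by gcongr; linarith
        _ = ‖x - q‖ := by rw [hR]; field_simp
    calc ‖x + z • v - q‖ = ‖(x - q) + z • v‖ := by congr 1; abel
      _ ≤ ‖x - q‖ + ‖z • v‖ := norm_add_le _ _
      _ ≤ 2 * ‖x - q‖ := by linarith
  have hmem' : ∀ z : ℂ, ‖z‖ ≤ R → x + z • v ∈ Metric.ball q ε := by
    intro z hz
    rw [Metric.mem_ball, dist_eq_norm]
    linarith [hmem z hz]
  have hxε : x ∈ Metric.ball q ε := by simpa using hmem' 0 (by simpa using hRpos.le)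
  have hder : HasDerivAt (fun z : ℂ => F (x + z • v)) (fderiv ℂ F x v) 0 := by
    have hx' : HasFDerivAt F (fderiv ℂ F x) (x + (0 : ℂ) • v) := by
      simpa using (hball x hxε).2.differentiableAt.hasFDerivAt
    have hl : HasDerivAt (fun z : ℂ => x + z • v) v 0 := by
      simpa using ((hasDerivAt_id (0 : ℂ)).smul_const v).const_add x
    exact hx'.comp_hasDerivAt (0 : ℂ) hl
  have hdiff : DiffContOnCl ℂ (fun z : ℂ => F (x + z • v)) (Metric.ball 0 R) := by
    refine DifferentiableOn.diffContOnCl fun z hz => ?_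
    have hz' : ‖z‖ ≤ R := by
      simpa using Metric.closure_ball_subset_closedBall hz
    refine DifferentiableAt.differentiableWithinAt ?_
    exact DifferentiableAt.comp z (hball _ (hmem' z hz')).2.differentiableAt (by fun_prop)
  have hest := Complex.norm_deriv_le_of_forall_mem_sphere_norm_le hRpos hdiff
    (C := c * (2 * ‖x - q‖) ^ k) fun z hz => by
      have hz' : ‖z‖ ≤ R := by
        rw [mem_sphere_zero_iff_norm] at hz
        exact hz.le
      refine ((hball _ (hmem' z hz')).1).trans ?_
      have h1 := hmem z hz'
      rw [Real.norm_of_nonneg (by positivity)]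
      by_cases hc0 : 0 ≤ c
      · gcongr
      · exfalso
        have h2 := (hball x hxε).1
        rw [Real.norm_of_nonneg (by positivity)] at h2
        have h3 : 0 < ‖x - q‖ ^ k := by positivity
        nlinarith [norm_nonneg (F x)]
  rw [hder.deriv] at hest
  refine hest.trans (le_of_eq ?_)
  rw [Real.norm_of_nonneg (by positivity), hR]
  obtain ⟨m, rfl⟩ : ∃ m, k = m + 1 := ⟨k - 1, by omega⟩
  rw [Nat.add_sub_cancel]
  field_simp
  ring

end LeadingForm

/-! ### The zero estimate -/

section ZeroEstimate

open MvPolynomial Asymptotics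

theorem hasFDerivAt_eval_mvPolynomial {κ E : Type*} [Fintype κ] [NormedAddCommGroup E]
    [NormedSpace ℂ E] {g : κ → E → ℂ} {g' : κ → E →L[ℂ] ℂ} {x : E}
    (hg : ∀ o, HasFDerivAt (g o) (g' o) x) (Φ : MvPolynomial κ ℂ) :
    HasFDerivAt (fun y => eval (fun o => g o y) Φ)
      (∑ o, eval (fun o => g o x) (pderiv o Φ) • g' o) x := by
  classical
  induction Φ using MvPolynomial.induction_on with
  | C a =>
    simp only [eval_C]
    refine (hasFDerivAt_const a x).congr_fderiv ?_
    ext v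
    simp
  | add p r hp hr =>
    simp only [map_add]
    refine (hp.add hr).congr_fderiv ?_
    ext v
    simp [sum_apply, add_mul, Finset.sum_add_distrib]
  | mul_X p o hp =>
    simp only [map_mul, eval_X]
    refine (hp.mul (hg o)).congr_fderiv ?_
    ext v
    have hX : ∀ o', eval (fun o => g o x) (pderiv o' (X o : MvPolynomial κ ℂ)) =
        if o' = o then 1 else 0 := fun o' => by
      rw [pderiv_X, Pi.single_apply]
      split_ifs <;> simp_all
    simp only [sum_apply, smul_apply, add_apply, Derivation.leibniz, smul_eq_mul, map_add, map_mul,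
      eval_X, hX, add_mul, Finset.sum_add_distrib, Finset.mul_sum, mul_assoc]
    simp

theorem analyticAt_eval_mvPolynomial {κ E : Type*} [NormedAddCommGroup E]
    [NormedSpace ℂ E] {g : κ → E → ℂ} {x : E} (hg : ∀ o, AnalyticAt ℂ (g o) x)
    (Φ : MvPolynomial κ ℂ) : AnalyticAt ℂ (fun y => eval (fun o => g o y) Φ) x := by
  induction Φ using MvPolynomial.induction_on with
  | C a => simpa using analyticAt_const
  | add p r hp hr =>
    simp only [map_add]
    exact hp.add hr
  | mul_X p o hp =>
    simp only [map_mul, eval_X]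
    exact hp.mul (hg o)

variable {ι E : Type*} [NormedAddCommGroup E] [NormedSpace ℂ E]

/-- The functions `H` and `G i`, as a family indexed by `Option ι`. A homogeneous polynomial of
degree `N` in them is `H ^ N` times a polynomial of degree at most `N` in the quotients
`G i / H`. -/
def denomNum (G : ι → E → ℂ) (H : E → ℂ) (o : Option ι) (x : E) : ℂ :=
  o.elim (H x) fun i => G i x

/-- The matrix of the differentials `H ^ 2 • d(G i / H) = H • d(G i) - G i • dH` in the
basis `b`. -/
noncomputable def quotientJacobian (b : Module.Basis ι ℂ E) (G : ι → E → ℂ) (H : E → ℂ) (x : E) :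
    Matrix ι ι ℂ :=
  Matrix.of fun i j => H x * fderiv ℂ (G i) x (b j) - G i x * fderiv ℂ H x (b j)

theorem analyticAt_denomNum {G : ι → E → ℂ} {H : E → ℂ} {q : E} (hG : ∀ i, AnalyticAt ℂ (G i) q)
    (hH : AnalyticAt ℂ H q) (o : Option ι) : AnalyticAt ℂ (denomNum G H o) q := by
  cases o with
  | none => exact hH
  | some i => exact hG i

theorem analyticAt_quotientJacobian (b : Module.Basis ι ℂ E) {G : ι → E → ℂ} {H : E → ℂ} {q : E}
    (hG : ∀ i, AnalyticAt ℂ (G i) q) (hH : AnalyticAt ℂ H q) (i j : ι) :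
    AnalyticAt ℂ (fun x => quotientJacobian b G H x i j) q := by
  have h1 : ∀ {F : E → ℂ}, AnalyticAt ℂ F q → AnalyticAt ℂ (fun x => fderiv ℂ F x (b j)) q :=
    fun hF => ((ContinuousLinearMap.apply ℂ ℂ (b j)).analyticAt _).comp hF.fderiv
  exact (hH.mul (h1 (hG i))).sub ((hG i).mul (h1 hH))

variable [Fintype ι]

/-- Euler's identity turns the differential of a homogeneous polynomial `Φ` in `H` and the `G i`
into a combination of the differentials of the quotients `G i / H`. -/
theorem fderiv_eval_denomNum (b : Module.Basis ι ℂ E) {G : ι → E → ℂ} {H : E → ℂ} {x : E}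
    (hG : ∀ i, DifferentiableAt ℂ (G i) x) (hH : DifferentiableAt ℂ H x) {N : ℕ}
    {Φ : MvPolynomial (Option ι) ℂ} (hΦ : Φ.IsHomogeneous N) (j : ι) :
    H x * fderiv ℂ (fun y => eval (fun o => denomNum G H o y) Φ) x (b j)
        - N * eval (fun o => denomNum G H o x) Φ * fderiv ℂ H x (b j)
      = ∑ i, eval (fun o => denomNum G H o x) (pderiv (some i) Φ) * quotientJacobian b G H x i j := by
  have hd : ∀ o, HasFDerivAt (denomNum G H o) (fderiv ℂ (denomNum G H o) x) x := fun o => by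
    cases o with
    | none => exact hH.hasFDerivAt
    | some i => exact (hG i).hasFDerivAt
  rw [(hasFDerivAt_eval_mvPolynomial hd Φ).fderiv]
  have heuler := congrArg (eval fun o => denomNum G H o x) hΦ.sum_X_mul_pderiv
  simp only [Fintype.sum_option, map_add, map_sum, map_mul, eval_X, nsmul_eq_mul,
    map_natCast] at heuler
  rw [← heuler]
  have hn : denomNum G H none = H := rfl
  have hs : ∀ i, denomNum G H (some i) = G i := fun i => rfl
  have hrhs : ∑ i, eval (fun o => denomNum G H o x) (pderiv (some i) Φ) *
        quotientJacobian b G H x i j =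
      H x * ∑ i, eval (fun o => denomNum G H o x) (pderiv (some i) Φ) * fderiv ℂ (G i) x (b j) -
        (∑ i, G i x * eval (fun o => denomNum G H o x) (pderiv (some i) Φ)) *
          fderiv ℂ H x (b j) := by
    rw [Finset.mul_sum, Finset.sum_mul, ← Finset.sum_sub_distrib]
    refine Finset.sum_congr rfl fun i _ => ?_
    rw [quotientJacobian, Matrix.of_apply]
    ring
  rw [hrhs]
  simp only [Fintype.sum_option, hn, hs, add_apply, smul_apply, sum_apply, smul_eq_mul]
  ring

variable [DecidableEq ι]

/-- A non-zero homogeneous polynomial of degree `N` in `H` and the `G i` cannot vanish to an order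
larger than a constant times `N`, when the quotients `G i / H` are functionally independent. Indeed
its partial derivatives can be recovered from its differential by inverting the Jacobian matrix, so
that each of them loses only a bounded amount of order. -/
theorem order_eval_denomNum_le (b : Module.Basis ι ℂ E) {G : ι → E → ℂ} {H : E → ℂ} {q : E}
    (hG : ∀ i, AnalyticAt ℂ (G i) q) (hH : AnalyticAt ℂ H q) {e δ : ℕ} {Q R : MvPolynomial ι ℂ}
    (hQ : IsLeadingForm b H q e Q)
    (hR : IsLeadingForm b (fun x => (quotientJacobian b G H x).det) q δ R) (N : ℕ) :
    ∀ (Φ : MvPolynomial (Option ι) ℂ), Φ.IsHomogeneous N → Φ ≠ 0 → ∀ k : ℕ,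
      (fun x => eval (fun o => denomNum G H o x) Φ) =O[𝓝 q] (fun x => ‖x - q‖ ^ k) →
      k ≤ N * (e + 1 + δ) := by
  induction N with
  | zero =>
    intro Φ hΦ h0 k hk
    rw [← totalDegree_zero_iff_isHomogeneous, totalDegree_eq_zero_iff_eq_C] at hΦ
    have hc : coeff 0 Φ ≠ 0 := fun h => h0 (by rw [hΦ, h, C_0])
    rw [hΦ] at hk
    simp only [eval_C] at hk
    by_contra! hlt
    refine hc (eq_zero_of_isBigO_of_tendsto (d := 0) (v := 0) hk (by omega) ?_)
    simp
  | succ N ih =>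
    intro Φ hΦ h0 k hk
    have hvals := analyticAt_denomNum hG hH
    have hF := analyticAt_eval_mvPolynomial hvals Φ
    by_cases hp : ∀ i, pderiv (some i) Φ = 0
    · -- By Euler's identity, `Φ` is then divisible by the variable that stands for `H`.
      set Ψ := C ((N + 1 : ℂ)⁻¹) * pderiv none Φ with hΨdef
      have hN : (N + 1 : ℂ) ≠ 0 := by exact_mod_cast N.succ_ne_zero
      have heq : Φ = X none * Ψ := by
        have h1 := hΦ.sum_X_mul_pderiv
        simp only [Fintype.sum_option, hp, mul_zero, Finset.sum_const_zero, add_zero,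
          nsmul_eq_mul] at h1
        rw [hΨdef, mul_left_comm, h1, ← map_natCast (C : ℂ →+* MvPolynomial (Option ι) ℂ),
          ← mul_assoc, ← C_mul]
        push_cast
        rw [inv_mul_cancel₀ hN, C_1, one_mul]
      have hΨ : Ψ.IsHomogeneous N := by simpa using hΦ.pderiv.C_mul ((N + 1 : ℂ)⁻¹)
      have hΨ0 : Ψ ≠ 0 := fun h => h0 (by rw [heq, h, mul_zero])
      have := ih Ψ hΨ hΨ0 _ (hQ.isBigO_of_mul (analyticAt_eval_mvPolynomial hvals Ψ)
        (hk.congr_left fun x => by rw [heq, map_mul, eval_X, mul_comm]; rfl))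
      have h3 : (N + 1) * (e + 1 + δ) = N * (e + 1 + δ) + e + 1 + δ := by ring
      omega
    · push Not at hp
      obtain ⟨i, hi⟩ := hp
      -- The vector of the functions `∂ᵢΦ(H, G)` times the Jacobian matrix is of order `k - 1`.
      have hrow : ∀ j, (fun x => ∑ i, eval (fun o => denomNum G H o x) (pderiv (some i) Φ) *
          quotientJacobian b G H x i j) =O[𝓝 q] fun x => ‖x - q‖ ^ (k - 1) := by
        intro j
        have hb : ∀ {u : E → ℂ}, AnalyticAt ℂ u q → u =O[𝓝 q] fun _ => (1 : ℝ) := fun hu =>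
          hu.continuousAt.tendsto.isBigO_one ℝ
        have hdH : AnalyticAt ℂ (fun x => fderiv ℂ H x (b j)) q :=
          ((ContinuousLinearMap.apply ℂ ℂ (b j)).analyticAt _).comp hH.fderiv
        have h1 := (hb hH).mul (hF.isBigO_fderiv hk (b j))
        have hk' : (fun x => eval (fun o => denomNum G H o x) Φ) =O[𝓝 q]
            fun x => ‖x - q‖ ^ (k - 1) := by
          refine hk.trans (isBigO_iff.mpr ⟨1, ?_⟩)
          filter_upwards [Metric.ball_mem_nhds q one_pos] with x hx
          rw [Metric.mem_ball, dist_eq_norm] at hx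
          simpa using pow_le_pow_of_le_one (norm_nonneg _) hx.le (Nat.sub_le k 1)
        have h2 := (hk'.const_mul_left ((N + 1 : ℕ) : ℂ)).mul (hb hdH)
        simp only [one_mul, mul_one] at h1 h2
        refine (h1.sub h2).congr' ?_ EventuallyEq.rfl
        filter_upwards [hH.eventually_analyticAt,
          eventually_all.mpr fun i => (hG i).eventually_analyticAt] with x hx1 hx2
        exact fderiv_eval_denomNum b (fun i => (hx2 i).differentiableAt) hx1.differentiableAt hΦ j
      have hdet : (fun x => eval (fun o => denomNum G H o x) (pderiv (some i) Φ) *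
          (quotientJacobian b G H x).det) =O[𝓝 q] fun x => ‖x - q‖ ^ (k - 1) := by
        have hadj : ∀ j, (fun x => (quotientJacobian b G H x).adjugate j i) =O[𝓝 q]
            fun _ => (1 : ℝ) := by
          intro j
          have hc : ContinuousAt (quotientJacobian b G H) q :=
            continuousAt_pi.mpr fun i => continuousAt_pi.mpr fun j =>
              (analyticAt_quotientJacobian b hG hH i j).continuousAt
          have hc2 : ContinuousAt (fun x => (quotientJacobian b G H x).adjugate) q :=
            (Continuous.matrix_adjugate continuous_id).continuousAt.comp hc
          exact (continuousAt_pi.mp (continuousAt_pi.mp hc2 j) i).tendsto.isBigO_one ℝ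
        have h1 := IsBigO.sum (s := Finset.univ) fun j (_ : j ∈ Finset.univ) =>
          (hrow j).mul (hadj j)
        simp only [mul_one] at h1
        refine h1.congr_left fun x => ?_
        have h2 : Matrix.vecMul (fun i => eval (fun o => denomNum G H o x) (pderiv (some i) Φ))
            (quotientJacobian b G H x * (quotientJacobian b G H x).adjugate) i =
            eval (fun o => denomNum G H o x) (pderiv (some i) Φ) *
              (quotientJacobian b G H x).det := by
          rw [Matrix.mul_adjugate, Matrix.vecMul_smul, Matrix.vecMul_one, Pi.smul_apply,
            smul_eq_mul, mul_comm]
        rw [← h2, ← Matrix.vecMul_vecMul, Finset.sum_apply]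
        rfl
      have := ih _ (by simpa using hΦ.pderiv (i := some i)) hi _
        (hR.isBigO_of_mul (analyticAt_eval_mvPolynomial hvals _) hdet)
      have h3 : (N + 1) * (e + 1 + δ) = N * (e + 1 + δ) + e + 1 + δ := by ring
      omega

end ZeroEstimate

/-! ### Counting the exponents of leading monomials -/

section Counting

open MvPolynomial Asymptotics

variable {ι : Type*} [Fintype ι]

/-- The polynomial `P (l₁ x₁, …, lₙ xₙ)`. -/
noncomputable def scaleVars (l : ι → ℂ) (P : MvPolynomial ι ℂ) : MvPolynomial ι ℂ :=
  ∑ γ ∈ P.support, monomial γ ((∏ i, l i ^ γ i) * coeff γ P)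

theorem coeff_scaleVars (l : ι → ℂ) (P : MvPolynomial ι ℂ) (γ : ι →₀ ℕ) :
    coeff γ (scaleVars l P) = (∏ i, l i ^ γ i) * coeff γ P := by
  classical
  simp only [scaleVars, coeff_sum, coeff_monomial, Finset.sum_ite_eq']
  by_cases h : γ ∈ P.support
  · simp [h]
  · simp [h, notMem_support_iff.mp h]

theorem eval_scaleVars (l : ι → ℂ) (P : MvPolynomial ι ℂ) (x : ι → ℂ) :
    eval x (scaleVars l P) = eval (fun i => l i * x i) P := by
  rw [scaleVars, map_sum, eval_eq']
  refine Finset.sum_congr rfl fun γ _ => ?_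
  rw [eval_monomial, Finsupp.prod_fintype _ _ fun i => pow_zero _]
  simp only [mul_pow, Finset.prod_mul_distrib]
  ring

theorem degree_scaleVars_le (m : MonomialOrder ι) (l : ι → ℂ) (P : MvPolynomial ι ℂ) :
    m.toSyn (m.degree (scaleVars l P)) ≤ m.toSyn (m.degree P) := by
  refine m.degree_le_iff.mpr fun γ hγ => m.le_degree ?_
  rw [mem_support_iff, coeff_scaleVars] at hγ
  exact mem_support_iff.mpr (right_ne_zero_of_mul hγ)

/-- If the quotient of `P` by `Q ^ N` is invariant under the diagonal map with entries `l`, then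
the leading exponents of `P` and of `Q ^ N` have the same eigenvalue. -/
theorem prod_pow_degree_eq (m : MonomialOrder ι) (l : ι → ℂ) {P Q : MvPolynomial ι ℂ} {N : ℕ}
    (hP : P ≠ 0) (hQ : Q ≠ 0) (h : scaleVars l P * Q ^ N = P * scaleVars l Q ^ N) :
    ∏ i, l i ^ m.degree P i = ∏ i, l i ^ (N • m.degree Q) i := by
  have hpow : scaleVars l Q ^ N = scaleVars l (Q ^ N) :=
    MvPolynomial.funext fun x => by simp only [map_pow, eval_scaleVars]
  have hc := congrArg (coeff (m.degree P + N • m.degree Q)) h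
  rw [hpow, m.coeff_mul_of_add_of_degree_le (degree_scaleVars_le m l P) (m.degree_pow_le _),
    m.coeff_mul_of_add_of_degree_le le_rfl
      ((degree_scaleVars_le m l _).trans (m.degree_pow_le _)),
    coeff_scaleVars, coeff_scaleVars, m.coeff_pow_nsmul_degree] at hc
  have h1 : coeff (m.degree P) P ≠ 0 := m.coeff_degree_ne_zero_iff.mpr hP
  have h2 : m.leadingCoeff Q ^ N ≠ 0 := pow_ne_zero _ (m.leadingCoeff_ne_zero_iff.mpr hQ)
  refine mul_right_cancel₀ (mul_ne_zero h1 h2) ?_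
  linear_combination hc

variable {E : Type*} [NormedAddCommGroup E] [NormedSpace ℂ E]

theorem HasFPowerSeriesAt.linearCombination {B : Type*} [Fintype B] {F : B → E → ℂ} {q : E}
    {p : B → FormalMultilinearSeries ℂ E ℂ} (h : ∀ β, HasFPowerSeriesAt (F β) (p β) q)
    (c : B → ℂ) :
    HasFPowerSeriesAt (fun x => ∑ β, c β * F β x) (Fintype.linearCombination ℂ p c) q := by
  classical
  rw [Fintype.linearCombination_apply]
  have : ∀ s : Finset B, HasFPowerSeriesAt (fun x => ∑ β ∈ s, c β * F β x)
      (∑ β ∈ s, c β • p β) q := by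
    intro s
    induction s using Finset.induction_on with
    | empty => simpa using hasFPowerSeriesAt_const (c := (0 : ℂ))
    | insert a s ha ih =>
      simp only [Finset.sum_insert ha]
      exact ((h a).const_smul (c := c a)).add ih
  exact this Finset.univ

/-- If a map fixes `q` and its linear part there is diagonal in the basis `b`, the leading forms
of an invariant quotient `F / H ^ N` form an invariant quotient of the linear part. -/
theorem IsLeadingForm.scaleVars_mul_pow_eq {b : Module.Basis ι ℂ E} {f : E → E} {q : E}
    (hq : f q = q) {A : E →L[ℂ] E} (hf : HasFDerivAt f A q) {l : ι → ℂ}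
    (hA : ∀ i, A (b i) = l i • b i) {F H : E → ℂ} {d e N : ℕ} {P Q : MvPolynomial ι ℂ}
    (hP : IsLeadingForm b F q d P) (hQ : IsLeadingForm b H q e Q)
    (hinv : ∀ᶠ x in 𝓝 q, F (f x) * H x ^ N = F x * H (f x) ^ N) :
    scaleVars l P * Q ^ N = P * scaleVars l Q ^ N := by
  rw [← sub_eq_zero]
  refine eq_zero_of_forall_eval_equivFun b fun v => ?_
  have hAv : b.equivFun (A v) = fun i => l i * b.equivFun v i := by
    conv_lhs => rw [← b.sum_equivFun v]
    simp only [map_sum, map_smul, hA]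
    funext i
    classical
    simp [Finsupp.single_apply, mul_comm]
  simp only [map_sub, map_mul, map_pow, eval_scaleVars, ← hAv]
  rw [sub_eq_zero]
  have hid : Tendsto (fun t : ℂ => t) (𝓝[≠] 0) (𝓝 0) := tendsto_id.mono_left nhdsWithin_le_nhds
  have hw : Tendsto (fun t : ℂ => t⁻¹ • (f (q + t • v) - q)) (𝓝[≠] 0) (𝓝 (A v)) := by
    have hl : HasDerivAt (fun t : ℂ => q + t • v) v 0 := by
      simpa using ((hasDerivAt_id (0 : ℂ)).smul_const v).const_add q
    have hf' : HasFDerivAt f A (q + (0 : ℂ) • v) := by simpa using hf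
    simpa [hq] using (hf'.comp_hasDerivAt (0 : ℂ) hl).tendsto_slope_zero
  have hc : Tendsto (fun _ : ℂ => v) (𝓝[≠] 0) (𝓝 v) := tendsto_const_nhds
  have hqt : Tendsto (fun t : ℂ => q + t • v) (𝓝[≠] 0) (𝓝 q) := by
    simpa using (hid.smul hc).const_add q
  refine tendsto_nhds_unique ((hP.tendsto hw).mul ((hQ.tendsto hc).pow N)) ?_
  refine ((hP.tendsto hc).mul ((hQ.tendsto hw).pow N)).congr' ?_
  filter_upwards [hqt.eventually hinv, self_mem_nhdsWithin] with t ht ht0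
  have ht0 : t ≠ 0 := ht0
  rw [smul_inv_smul₀ ht0, add_sub_cancel]
  simp only [mul_pow]
  linear_combination (-(t ^ d)⁻¹ * ((t ^ e)⁻¹) ^ N) * ht

/-- Functionally independent first integrals `G i / H`, as many as the dimension, force many
monomials of bounded degree to share the same eigenvalue under the linear part of the map. -/
theorem exists_pow_card_le_card [LinearOrder ι] (b : Module.Basis ι ℂ E) {f : E → E} {q : E}
    (hq : f q = q) {A : E →L[ℂ] E} (hf : HasFDerivAt f A q) {l : ι → ℂ}
    (hA : ∀ i, A (b i) = l i • b i) {G : ι → E → ℂ} {H : E → ℂ}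
    (hG : ∀ i, AnalyticAt ℂ (G i) q) (hH : AnalyticAt ℂ H q) (hH0 : ¬ ∀ᶠ x in 𝓝 q, H x = 0)
    (hJ : ¬ ∀ᶠ x in 𝓝 q, (quotientJacobian b G H x).det = 0)
    (hinv : ∀ i, ∀ᶠ x in 𝓝 q, G i (f x) * H x = G i x * H (f x)) :
    ∃ K : ℕ, ∀ n : ℕ, ∃ κ : ℂ, ∀ S : Finset (ι →₀ ℕ),
      (∀ γ : ι →₀ ℕ, γ.degree ≤ K * n → ∏ i, l i ^ γ i = κ → γ ∈ S) →
      (n + 1) ^ Fintype.card ι ≤ S.card := by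
  classical
  obtain ⟨pH, hpH⟩ := id hH
  obtain ⟨e, hQ, -⟩ := hpH.exists_isLeadingForm b hH0
  have hJan : AnalyticAt ℂ (fun x => (quotientJacobian b G H x).det) q := by
    simp only [Matrix.det_apply]
    refine Finset.analyticAt_fun_sum _ fun σ _ => ?_
    refine AnalyticAt.const_smul ?_
    exact Finset.analyticAt_fun_prod _ fun i _ => analyticAt_quotientJacobian b hG hH _ _
  obtain ⟨pJ, hpJ⟩ := hJan
  obtain ⟨δ, hR, -⟩ := hpJ.exists_isLeadingForm b hJ
  set Q := taylorForm b e pH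
  refine ⟨Fintype.card ι * (e + 1 + δ), fun n => ?_⟩
  set N := Fintype.card ι * n with hN
  let m : MonomialOrder ι := MonomialOrder.lex
  refine ⟨∏ i, l i ^ (N • m.degree Q) i, fun S hS => ?_⟩
  -- The `(n + 1) ^ card ι` monomials of degree at most `n` in each variable, homogenized to
  -- degree `N`.
  let mon : (ι → Fin (n + 1)) → Option ι →₀ ℕ := fun β =>
    Finsupp.equivFunOnFinite.symm fun o => o.elim (N - ∑ i, (β i : ℕ)) fun i => β i
  have hmon_inj : Function.Injective mon := by
    intro β β' h
    funext i
    have := DFunLike.congr_fun h (some i)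
    exact Fin.ext this
  have hmon_deg : ∀ β, (mon β).degree = N := by
    intro β
    have hle : ∑ i, (β i : ℕ) ≤ N := by
      calc ∑ i, (β i : ℕ) ≤ ∑ _i : ι, n := Finset.sum_le_sum fun i _ => by omega
        _ = N := by simp [hN]
    rw [Finsupp.degree_eq_sum, Fintype.sum_option]
    simp only [mon, Finsupp.equivFunOnFinite_symm_apply_apply, Option.elim_none, Option.elim_some]
    omega
  let Φ : ((ι → Fin (n + 1)) → ℂ) → MvPolynomial (Option ι) ℂ := fun c =>
    ∑ β, monomial (mon β) (c β)
  have hΦhom : ∀ c, (Φ c).IsHomogeneous N := fun c =>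
    IsHomogeneous.sum _ _ _ fun β _ => isHomogeneous_monomial _ (hmon_deg β)
  have hΦ0 : ∀ c, c ≠ 0 → Φ c ≠ 0 := by
    intro c hc h
    apply hc
    funext β
    have := congrArg (coeff (mon β)) h
    simpa [Φ, coeff_sum, coeff_monomial, hmon_inj.eq_iff] using this
  have hvals := analyticAt_denomNum hG hH
  choose p hp using fun β => analyticAt_eval_mvPolynomial hvals (monomial (mon β) (1 : ℂ))
  have hpc : ∀ c, HasFPowerSeriesAt (fun x => eval (fun o => denomNum G H o x) (Φ c))
      (Fintype.linearCombination ℂ p c) q := by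
    intro c
    convert HasFPowerSeriesAt.linearCombination hp c using 2 with x
    simp [Φ, map_sum, eval_monomial]
  -- The linear map that extracts the Taylor coefficients at the exponents in `S`.
  let T : ((ι → Fin (n + 1)) → ℂ) →ₗ[ℂ] (S → ℂ) := LinearMap.pi fun γ =>
    (lcoeff ℂ (γ : ι →₀ ℕ)) ∘ₗ taylorForm b (γ : ι →₀ ℕ).degree ∘ₗ Fintype.linearCombination ℂ p
  have hT : Function.Injective T := by
    rw [← LinearMap.ker_eq_bot, LinearMap.ker_eq_bot']
    intro c hTc
    by_contra hc
    have hord := order_eval_denomNum_le b hG hH hQ hR N (Φ c) (hΦhom c) (hΦ0 c hc)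
    have hF0 : ¬ ∀ᶠ x in 𝓝 q, eval (fun o => denomNum G H o x) (Φ c) = 0 := fun h0 => by
      have := hord (N * (e + 1 + δ) + 1) ((isBigO_zero _ _).congr'
        (h0.mono fun x hx => hx.symm) EventuallyEq.rfl)
      omega
    obtain ⟨d, hP, hO⟩ := (hpc c).exists_isLeadingForm b hF0
    set P := taylorForm b d (Fintype.linearCombination ℂ p c) with hPdef
    have hFinv : ∀ᶠ x in 𝓝 q, eval (fun o => denomNum G H o (f x)) (Φ c) * H x ^ N =
        eval (fun o => denomNum G H o x) (Φ c) * H (f x) ^ N := by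
      filter_upwards [eventually_all.mpr hinv] with x hx
      have hscale : ∀ (s : ℂ) (u : Option ι → ℂ),
          eval u (Φ c) * s ^ N = eval (fun o => u o * s) (Φ c) := by
        intro s u
        rw [eval_eq', eval_eq', Finset.sum_mul]
        refine Finset.sum_congr rfl fun γ hγ => ?_
        have hdeg : ∑ o, γ o = N := by
          rw [← Finsupp.degree_eq_sum]
          exact ((hΦhom c).degree_eq_sum_deg_support hγ).symm
        simp only [mul_pow, Finset.prod_mul_distrib, Finset.prod_pow_eq_pow_sum, hdeg]
        ring
      rw [hscale, hscale]
      congr 2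
      funext o
      cases o with
      | none => exact mul_comm _ _
      | some i => exact hx i
    have heig := prod_pow_degree_eq m l hP.ne_zero hQ.ne_zero
      (hP.scaleVars_mul_pow_eq hq hf hA hQ hFinv)
    have hmem := m.degree_mem_support hP.ne_zero
    have hdeg : (m.degree P).degree = d := (hP.isHomogeneous.degree_eq_sum_deg_support hmem).symm
    have hγ : m.degree P ∈ S := by
      refine hS _ ?_ heig
      rw [hdeg]
      refine (hord d hO).trans (le_of_eq ?_)
      rw [hN]
      ring
    refine mem_support_iff.mp hmem ?_
    have h1 : coeff (m.degree P) (taylorForm b (m.degree P).degree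
      (Fintype.linearCombination ℂ p c)) = 0 := congrFun hTc ⟨_, hγ⟩
    rwa [hdeg] at h1
  have hfin := LinearMap.finrank_le_finrank_of_injective hT
  simpa using hfin

end Counting

/-! ### Integrability and the eigenvalues of the linear part -/

section Integrability

/-- Functionally independent meromorphic functions can be written with a common denominator, and
their Jacobian determinant then does not vanish identically. -/
theorem HasIndependentMeromorphicFirstIntegralsAt.exists_common_denominator {n : ℕ}
    {f : (Fin n → ℂ) → (Fin n → ℂ)} {q : Fin n → ℂ}
    (h : HasIndependentMeromorphicFirstIntegralsAt f q n) (b : Module.Basis (Fin n) ℂ (Fin n → ℂ)) :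
    ∃ (G : Fin n → (Fin n → ℂ) → ℂ) (H : (Fin n → ℂ) → ℂ),
      (∀ i, AnalyticAt ℂ (G i) q) ∧ AnalyticAt ℂ H q ∧ (¬ ∀ᶠ x in 𝓝 q, H x = 0) ∧
      (¬ ∀ᶠ x in 𝓝 q, (quotientJacobian b G H x).det = 0) ∧
      ∀ i, ∀ᶠ x in 𝓝 q, G i (f x) * H x = G i x * H (f x) := by
  obtain ⟨G, H, hfi, hind⟩ := h
  set H' : (Fin n → ℂ) → ℂ := fun x => ∏ j, H j x with hH'
  set G' : Fin n → (Fin n → ℂ) → ℂ := fun i x => G i x * ∏ j ∈ Finset.univ.erase i, H j x with hG'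
  have hsplit : ∀ i x, H' x = H i x * ∏ j ∈ Finset.univ.erase i, H j x := fun i x =>
    (Finset.mul_prod_erase _ _ (Finset.mem_univ i)).symm
  have hHan : AnalyticAt ℂ H' q := Finset.analyticAt_fun_prod _ fun j _ => (hfi j).analyticAt_den
  have hGan : ∀ i, AnalyticAt ℂ (G' i) q := fun i => (hfi i).analyticAt_num.mul
    (Finset.analyticAt_fun_prod _ fun j _ => (hfi j).analyticAt_den)
  refine ⟨G', H', hGan, hHan, fun h0 => ?_, fun h0 => ?_, fun i => ?_⟩
  · obtain ⟨x, hx, hx0⟩ := (hind.and_eventually h0).exists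
    exact Finset.prod_ne_zero_iff.mpr (fun j _ => hx.1 j) hx0
  · have hana := (eventually_all.mpr fun i => (hfi i).analyticAt_num.eventually_analyticAt).and
      (eventually_all.mpr fun i => (hfi i).analyticAt_den.eventually_analyticAt)
    obtain ⟨x, ⟨hx, hli⟩, hdet, ⟨hxG, hxH⟩, hxH'⟩ :=
      (hind.and_eventually (h0.and (hana.and hHan.eventually_analyticAt))).exists
    have hH'x : H' x ≠ 0 := Finset.prod_ne_zero_iff.mpr fun j _ => hx j
    -- The rows of the matrix are `H ^ 2` times the differentials of the quotients.
    have hrow : ∀ i j, quotientJacobian b G' H' x i j =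
        H' x ^ 2 * fderiv ℂ (fun y => G i y / H i y) x (b j) := by
      intro i j
      have hR : DifferentiableAt ℂ (fun y => G i y / H i y) x :=
        ((hxG i).fun_div (hxH i) (hx i)).differentiableAt
      have heq : G' i =ᶠ[𝓝 x] fun y => G i y / H i y * H' y := by
        filter_upwards [(hxH i).continuousAt.eventually_ne (hx i)] with y hy
        rw [hsplit i y]
        simp only [hG']
        field_simp
      have hd : fderiv ℂ (G' i) x (b j) = G i x / H i x * fderiv ℂ H' x (b j) +
          H' x * fderiv ℂ (fun y => G i y / H i y) x (b j) := by
        rw [heq.fderiv_eq, fderiv_fun_mul hR hxH'.differentiableAt]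
        simp
      simp only [quotientJacobian, Matrix.of_apply, hd, heq.eq_of_nhds]
      ring
    obtain ⟨v, hv0, hv⟩ := Matrix.exists_vecMul_eq_zero_iff.mpr hdet
    apply hv0
    have hsum : ∑ i, v i • fderiv ℂ (fun y => G i y / H i y) x = 0 := by
      refine ContinuousLinearMap.coe_injective (b.ext fun j => ?_)
      have := congrFun hv j
      simp only [Matrix.vecMul, dotProduct, hrow, Pi.zero_apply] at this
      have h2 : H' x ^ 2 * ∑ i, v i * fderiv ℂ (fun y => G i y / H i y) x (b j) = 0 := by
        rw [← this, Finset.mul_sum]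
        exact Finset.sum_congr rfl fun i _ => by ring
      have h3 := (mul_eq_zero.mp h2).resolve_left (pow_ne_zero _ hH'x)
      simpa [sum_apply] using h3
    exact funext (Fintype.linearIndependent_iff.mp hli v hsum)
  · filter_upwards [(hfi i).invariant] with x hx
    rw [hsplit i x, hsplit i (f x)]
    simp only [hG']
    linear_combination (∏ j ∈ Finset.univ.erase i, H j x) *
      (∏ j ∈ Finset.univ.erase i, H j (f x)) * hx

/-- A map of `ℂ³` whose linear part at a fixed point has the eigenvalues `-1`, `μ` and `μ⁻¹` has
no three functionally independent meromorphic first integrals there, unless `μ` is a root of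
unity. -/
theorem exists_pow_eq_one_of_hasIndependentMeromorphicFirstIntegralsAt
    {f : (Fin 3 → ℂ) → (Fin 3 → ℂ)} {q : Fin 3 → ℂ} (hq : f q = q)
    {A : (Fin 3 → ℂ) →L[ℂ] (Fin 3 → ℂ)} (hf : HasFDerivAt f A q)
    (b : Module.Basis (Fin 3) ℂ (Fin 3 → ℂ)) {μ : ℂ} (hμ : μ ≠ 0)
    (hA : ∀ i, A (b i) = (![-1, μ, μ⁻¹] : Fin 3 → ℂ) i • b i)
    (h : HasIndependentMeromorphicFirstIntegralsAt f q 3) : ∃ k : ℕ, 0 < k ∧ μ ^ k = 1 := by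
  classical
  by_contra! hμ1
  have hinj : ∀ a c : ℕ, μ ^ a = μ ^ c → a = c := by
    have key : ∀ a c : ℕ, a < c → μ ^ a ≠ μ ^ c := fun a c hac hpow => by
      refine hμ1 (c - a) (by omega) (mul_left_cancel₀ (pow_ne_zero a hμ) ?_)
      rw [← pow_add, Nat.add_sub_cancel' hac.le, mul_one, hpow]
    intro a c hac
    rcases lt_trichotomy a c with hlt | heq | hgt
    · exact absurd hac (key _ _ hlt)
    · exact heq
    · exact absurd hac.symm (key _ _ hgt)
  obtain ⟨G, H, hG, hH, hH0, hJ, hinv⟩ := h.exists_common_denominator b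
  obtain ⟨K, hK⟩ := exists_pow_card_le_card b hq hf hA hG hH hH0 hJ hinv
  -- This value of `n` makes `(n + 1) ^ 3` larger than `(K * n + 1) ^ 2`.
  set n := (K + 1) ^ 2 with hn
  obtain ⟨κ, hκ⟩ := hK n
  set r := Finset.range (K * n + 1)
  let toExp : ℕ × ℕ × ℕ → Fin 3 →₀ ℕ := fun t => Finsupp.equivFunOnFinite.symm ![t.1, t.2.1, t.2.2]
  let S := ((r ×ˢ r ×ˢ r).image toExp).filter
    fun γ => ∏ i, (![-1, μ, μ⁻¹] : Fin 3 → ℂ) i ^ γ i = κ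
  have h1 := hκ S fun γ hdeg hγ => by
    rw [Finsupp.degree_eq_sum, Fin.sum_univ_three] at hdeg
    refine Finset.mem_filter.mpr ⟨Finset.mem_image.mpr ⟨(γ 0, γ 1, γ 2), ?_, ?_⟩, hγ⟩
    · simp only [r, Finset.mem_product, Finset.mem_range]
      omega
    · ext i
      fin_cases i <;> rfl
  -- The eigenvalue and the first two exponents determine the third one.
  have h2 : S.card ≤ (r ×ˢ r).card := by
    refine Finset.card_le_card_of_injOn (fun γ => (γ 0, γ 1)) ?_ ?_
    · intro γ hγ
      obtain ⟨t, ht, rfl⟩ := Finset.mem_image.mp (Finset.mem_filter.mp hγ).1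
      simp only [Finset.mem_product] at ht
      exact Finset.mem_coe.mpr (Finset.mem_product.mpr ⟨ht.1, ht.2.1⟩)
    · intro γ hγ γ' hγ' heq
      have e1 := (Finset.mem_filter.mp hγ).2
      have e2 := (Finset.mem_filter.mp hγ').2
      rw [← e2] at e1
      obtain ⟨h0, h1⟩ := Prod.ext_iff.mp heq
      simp only at h0 h1
      simp only [Fin.prod_univ_three, Matrix.cons_val_zero, Matrix.cons_val_one,
        Matrix.cons_val, h0, h1] at e1
      have e3 := mul_left_cancel₀ (mul_ne_zero (pow_ne_zero _ (by norm_num)) (pow_ne_zero _ hμ)) e1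
      rw [inv_pow, inv_pow, inv_inj] at e3
      have e4 := hinj _ _ e3
      ext i
      fin_cases i
      · exact h0
      · exact h1
      · exact e4
  have h3 : (n + 1) ^ 3 ≤ (K * n + 1) ^ 2 := by
    simpa [r, sq] using h1.trans h2
  have h4 : (K * n + 1) ^ 2 ≤ ((K + 1) * (n + 1)) ^ 2 := by
    apply Nat.pow_le_pow_left
    nlinarith
  have h5 : ((K + 1) * (n + 1)) ^ 2 = n * (n + 1) ^ 2 := by rw [mul_pow]
  have h6 : (n + 1) ^ 3 = n * (n + 1) ^ 2 + (n + 1) ^ 2 := by ring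
  have h7 : 0 < (n + 1) ^ 2 := by positivity
  omega

end Integrability

/-! ### The fixed points of the map -/

section Todd

theorem isToddFixedPoint_const {a x : ℂ} (hx : x ≠ 0) (hax : x ^ 2 = a + 2 * x) :
    IsToddFixedPoint a fun _ => x := by
  refine ⟨hx, ?_⟩
  funext i
  fin_cases i
  · rfl
  · rfl
  · simp only [toddMap, Matrix.cons_val, Fin.reduceFinMk]
    field_simp
    linear_combination -hax

/-- The linear part of the map at its fixed point `(x, x, x)`. -/
noncomputable def toddLinearPart (x : ℂ) : (Fin 3 → ℂ) →L[ℂ] (Fin 3 → ℂ) :=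
  let π : Fin 3 → ((Fin 3 → ℂ) →L[ℂ] ℂ) := ContinuousLinearMap.proj
  ContinuousLinearMap.pi ![π 1, π 2, -π 0 + x⁻¹ • (π 1 + π 2)]

theorem toddLinearPart_apply (x : ℂ) (v : Fin 3 → ℂ) :
    toddLinearPart x v = ![v 1, v 2, -v 0 + x⁻¹ * (v 1 + v 2)] := by
  funext i
  fin_cases i <;> rfl

theorem hasFDerivAt_toddMap {a x : ℂ} (hx : x ≠ 0) (hax : x ^ 2 = a + 2 * x) :
    HasFDerivAt (toddMap a) (toddLinearPart x) (fun _ => x) := by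
  have hp : ∀ i : Fin 3, HasFDerivAt (fun p : Fin 3 → ℂ => p i)
      (ContinuousLinearMap.proj i : (Fin 3 → ℂ) →L[ℂ] ℂ) (fun _ => x) := fun i =>
    hasFDerivAt_apply i _
  refine hasFDerivAt_pi'.mpr fun i => ?_
  fin_cases i
  · exact hp 1
  · exact hp 2
  · have h1 := (((hp 1).const_add a).add (hp 2)).mul
      ((hasDerivAt_inv hx).comp_hasFDerivAt (fun _ : Fin 3 => x) (hp 0))
    refine h1.congr_fderiv ?_
    ext v
    simp [smul_apply, add_apply, toddLinearPart_apply]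
    field_simp
    linear_combination v 0 * hax

/-- At the fixed point `(x, x, x)` the characteristic polynomial of the linear part is
`(λ + 1) (λ ^ 2 - (1 + 1 / x) λ + 1)`. If `μ` is not a root of unity, its three roots are distinct
and the linear part is diagonal in the basis of the eigenvectors `(1, λ, λ ^ 2)`. -/
theorem exists_pow_eq_one_of_todd {a x μ : ℂ} (hx : x ≠ 0) (hax : x ^ 2 = a + 2 * x) (hμ : μ ≠ 0)
    (hμx : μ + μ⁻¹ = 1 + x⁻¹)
    (h : HasIndependentMeromorphicFirstIntegralsAt (toddMap a) (fun _ => x) 3) :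
    ∃ k : ℕ, 0 < k ∧ μ ^ k = 1 := by
  by_contra hne
  have hne' := hne
  push Not at hne'
  have hμ2 : μ ^ 2 ≠ 1 := hne' 2 two_pos
  set l : Fin 3 → ℂ := ![-1, μ, μ⁻¹] with hl
  have hl1 : (-1 : ℂ) ≠ μ := fun h => hμ2 (by rw [← h]; norm_num)
  have hl2 : (-1 : ℂ) ≠ μ⁻¹ := fun h => hl1 (by rw [← inv_inv μ, ← h]; norm_num)
  have hl3 : μ ≠ μ⁻¹ := fun h => hμ2 (by
    rw [sq]
    nth_rewrite 2 [h]
    exact mul_inv_cancel₀ hμ)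
  have hinj : Function.Injective l := by
    intro i j hij
    fin_cases i <;> fin_cases j <;> simp_all [eq_comm]
  have hli : LinearIndependent ℂ (Matrix.vandermonde l).row :=
    Matrix.linearIndependent_rows_of_det_ne_zero (Matrix.det_vandermonde_ne_zero_iff.mpr hinj)
  let b := basisOfLinearIndependentOfCardEqFinrank hli (by simp)
  have hroot : ∀ i, l i ^ 3 = -1 + x⁻¹ * (l i + l i ^ 2) := by
    have hm : μ * μ⁻¹ = 1 := mul_inv_cancel₀ hμ
    intro i
    fin_cases i
    · simp only [hl, Fin.zero_eta, Matrix.cons_val_zero]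
      ring
    · simp only [hl, Fin.mk_one, Matrix.cons_val_one, Matrix.cons_val_zero]
      linear_combination (μ + μ ^ 2) * hμx - (1 + μ) * hm
    · simp only [hl, Fin.reduceFinMk, Matrix.cons_val]
      linear_combination (μ⁻¹ + μ⁻¹ ^ 2) * hμx - (1 + μ⁻¹) * hm
  refine hne (exists_pow_eq_one_of_hasIndependentMeromorphicFirstIntegralsAt
    (isToddFixedPoint_const hx hax).2 (hasFDerivAt_toddMap hx hax) b hμ (fun i => ?_) h)
  have hb : b i = fun j : Fin 3 => l i ^ (j : ℕ) := by
    rw [coe_basisOfLinearIndependentOfCardEqFinrank]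
    rfl
  change _ = l i • b i
  rw [hb, toddLinearPart_apply]
  funext j
  fin_cases j
  · simp
  · simp [sq]
  · simp
    linear_combination -hroot i

/-- Here `1 + x⁻¹` is the sum `μ + μ⁻¹` of two eigenvalues, which are roots of unity. -/
theorem isIntegral_and_norm_le_of_todd {a x : ℂ} (hx : x ≠ 0) (hax : x ^ 2 = a + 2 * x)
    (h : HasIndependentMeromorphicFirstIntegralsAt (toddMap a) (fun _ => x) 3) :
    IsIntegral ℤ (1 + x⁻¹) ∧ ‖1 + x⁻¹‖ ≤ 2 := by
  obtain ⟨s, hs⟩ := IsAlgClosed.exists_eq_mul_self ((1 + x⁻¹) ^ 2 - 4)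
  set c := 1 + x⁻¹ with hc
  have hprod : (c + s) / 2 * ((c - s) / 2) = 1 := by linear_combination (-1 / 4 : ℂ) * hs.symm
  have hμ : (c + s) / 2 ≠ 0 := left_ne_zero_of_mul_eq_one hprod
  have hinv : ((c + s) / 2)⁻¹ = (c - s) / 2 := inv_eq_of_mul_eq_one_right hprod
  have hsum : (c + s) / 2 + ((c + s) / 2)⁻¹ = c := by rw [hinv]; ring
  obtain ⟨k, hk, hk1⟩ := exists_pow_eq_one_of_todd hx hax hμ hsum h
  rw [← hsum]
  have hk2 : (((c + s) / 2)⁻¹) ^ k = 1 := by rw [inv_pow, hk1, inv_one]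
  constructor
  · exact (IsIntegral.of_pow hk (hk1 ▸ isIntegral_one)).add
      (IsIntegral.of_pow hk (hk2 ▸ isIntegral_one))
  · refine (norm_add_le _ _).trans (le_of_eq ?_)
    rw [Complex.norm_eq_one_of_pow_eq_one hk1 hk.ne', Complex.norm_eq_one_of_pow_eq_one hk2 hk.ne']
    norm_num

theorem exists_int_eq_of_isIntegral_ratCast {r : ℚ} (h : IsIntegral ℤ (r : ℂ)) :
    ∃ m : ℤ, (m : ℚ) = r := by
  have h1 : IsIntegral ℤ (algebraMap ℚ ℂ r) := by simpa using h
  rw [isIntegral_algebraMap_iff (algebraMap ℚ ℂ).injective] at h1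
  simpa using IsIntegrallyClosed.isIntegral_iff.mp h1

end Todd

theorem mainTheorem9 (a : ℚ)
    (h : ∀ q : Fin 3 → ℂ, IsToddFixedPoint (a : ℂ) q →
      HasIndependentMeromorphicFirstIntegralsAt (toddMap (a : ℂ)) q 3) :
    a ∈ ({-1, 1} : Set ℚ) := by
  have key : ∀ x : ℂ, x ≠ 0 → x ^ 2 = a + 2 * x → IsIntegral ℤ (1 + x⁻¹) ∧ ‖1 + x⁻¹‖ ≤ 2 :=
    fun x hx hax => isIntegral_and_norm_le_of_todd hx hax (h _ (isToddFixedPoint_const hx hax))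
  by_cases ha : a = 0
  · -- The only fixed point is `(2, 2, 2)`, and `1 + 1 / 2` is not an integer.
    subst ha
    exfalso
    obtain ⟨m, hm⟩ := exists_int_eq_of_isIntegral_ratCast (r := 3 / 2) (by
      convert (key 2 two_ne_zero (by norm_num)).1 using 1
      norm_num)
    have h2 : 2 * m = 3 := by
      have : (2 * m : ℚ) = 3 := by rw [hm]; norm_num
      exact_mod_cast this
    omega
  have haC : (a : ℂ) ≠ 0 := by exact_mod_cast ha
  obtain ⟨s, hs⟩ := IsAlgClosed.exists_eq_mul_self (1 + a : ℂ)
  have hprod : (1 + s) * (1 - s) = -(a : ℂ) := by linear_combination hs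
  have hx1 : 1 + s ≠ 0 := left_ne_zero_of_mul (hprod ▸ neg_ne_zero.mpr haC)
  have hx2 : 1 - s ≠ 0 := right_ne_zero_of_mul (hprod ▸ neg_ne_zero.mpr haC)
  obtain ⟨i1, n1⟩ := key (1 + s) hx1 (by linear_combination -hs)
  obtain ⟨i2, n2⟩ := key (1 - s) hx2 (by linear_combination -hs)
  have hinv : (a : ℂ)⁻¹ = -((1 + s)⁻¹ * (1 - s)⁻¹) := by
    rw [← mul_inv, hprod, inv_neg, neg_neg]
  have hadd : (1 + (1 + s)⁻¹) + (1 + (1 - s)⁻¹) = ((2 - 2 * a⁻¹ : ℚ) : ℂ) := by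
    push_cast
    rw [hinv]
    field_simp
    ring
  have hmul : (1 + (1 + s)⁻¹) * (1 + (1 - s)⁻¹) = ((1 - 3 * a⁻¹ : ℚ) : ℂ) := by
    push_cast
    rw [hinv]
    field_simp
    ring
  obtain ⟨u, hu⟩ := exists_int_eq_of_isIntegral_ratCast (hadd ▸ i1.add i2)
  obtain ⟨v, hv⟩ := exists_int_eq_of_isIntegral_ratCast (hmul ▸ i1.mul i2)
  have hbound : |1 - 3 * a⁻¹| ≤ 4 := by
    have h1 : ‖((1 - 3 * a⁻¹ : ℚ) : ℂ)‖ ≤ 2 * 2 := by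
      rw [← hmul, norm_mul]
      exact mul_le_mul n1 n2 (norm_nonneg _) zero_le_two
    have h2 : ‖((1 - 3 * a⁻¹ : ℚ) : ℂ)‖ = ((|1 - 3 * a⁻¹| : ℚ) : ℝ) := by
      rw [← Complex.ofReal_ratCast, Complex.norm_real, Real.norm_eq_abs, Rat.cast_abs]
    rw [h2] at h1
    have h3 : ((|1 - 3 * a⁻¹| : ℚ) : ℝ) ≤ (4 : ℚ) := h1.trans (by norm_num)
    exact_mod_cast h3
  -- Both `2 / a` and `3 / a` are integers, hence so is their difference `1 / a`.
  obtain ⟨m, hm⟩ : ∃ m : ℤ, (m : ℚ) = a⁻¹ := ⟨u - v - 1, by push_cast; rw [hu, hv]; ring⟩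
  rw [← hm, abs_le] at hbound
  have hb1 : -4 ≤ 1 - 3 * m := by exact_mod_cast hbound.1
  have hb2 : 1 - 3 * m ≤ 4 := by exact_mod_cast hbound.2
  have hm0 : m ≠ 0 := by
    rintro rfl
    exact inv_ne_zero ha (by simpa using hm.symm)
  have ha' : a = (m : ℚ)⁻¹ := by rw [hm, inv_inv]
  rcases (by omega : m = -1 ∨ m = 1) with rfl | rfl
  · left
    rw [ha']
    norm_num
  · right
    rw [ha']
    norm_num
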